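/- Let $n\ge 1$ and $0\le m\le n$ be integers, and let $X^n$ be a random binary dataset of length $n$ whose distribution has full support on $\{0,1\}^n$. For $x^n\in\{0,1\}^n$ let $P_{x^n}$ be its type (empirical distribution), $T(i)=\{x^n: nP_{x^n}(0)=i\}$ for $0\le i\le n$ the type classes, and $d(x^n,y^n)=\max_{a\in\{0,1\}}|P_{x^n}(a)-P_{y^n}(a)|$. For a mechanism $P_{Y^n|X^n}$ with outputs in $\{0,1\}^n$, and $\alpha\in(1,\infty]$, the maximal $\alpha$-leakage is $$\mathcal L_\alpha^{\max}(X^n\to Y^n)=\sup_{U-X^n-Y^n}\ \lim_{\alpha'\to\alpha}\frac{\alpha'}{\alpha'-1}\log\frac{\max_{P_{\hat U|Y^n}}\mathbb E\big[P_{\hat U|Y^n}(U|Y^n)^{(\alpha'-1)/\alpha'}\big]}{\max_{P_{\hat U}}\mathbb E\big[P_{\hat U}(U)^{(\alpha'-1)/\alpha'}\big]},$$ where the supremum is over all (possibly randomized) functions $U$ of $X^n$ with values in a finite alphabet. A mechanism is feasible if $d(X^n,Y^n)\le \frac mn$ with probability one, and $\mathrm{PUT}_\alpha(\frac mn)$ denotes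 the infimum of $\mathcal L_\alpha^{\max}(X^n\to Y^n)$ over all feasible mechanisms. Put $K=\left\lceil\frac{n+1}{2m+1}\right\rceil$. Then for every $\alpha\in(1,\infty]$, $$\mathrm{PUT}_\alpha\Big(\frac mn\Big)=\log\left\lceil\frac{n+1}{2m+1}\right\rceil .$$ Moreover, let $l=m$ if $m+(K-1)(2m+1)\le n$, and $l=n-(K-1)(2m+1)$ otherwise, and let $$\mathcal T^*=\{T(j): j=l+(2m+1)k,\ k\in\{0,1,\dots,K-1\}\}.$$ The classes in $\mathcal T^*$ are non-empty. Choose, arbitrarily, one dataset from each class in $\mathcal T^*$. Then for each dataset $x^n$ exactly one of the chosen datasets, denoted $f(x^n)$, satisfies $d(x^n,f(x^n))\le\frac mn$; $f$ is constant on each type class; and the deterministic mechanism $Y^n=f(X^n)$ is feasible and attains $\mathrm{PUT}_\alpha(\frac mn)$ for every $\alpha\in(1,\infty]$ simultaneously. -/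

import Mathlib

open Filter Topology
open scoped ENNReal

noncomputable section

namespace HardDistortion

/-- A channel (row-stochastic matrix) `P_{Y|X}` between finite alphabets: each input letter is
sent to a probability mass function on the output alphabet. -/
abbrev Channel (A B : Type) [Fintype B] : Type := A → stdSimplex ℝ B

section Leakage

variable {A B C : Type} [Fintype A] [Fintype B] [Fintype C]

/-- The joint law of `(U, Y)` for the Markov chain `U - X - Y` in which `X ∼ P`, and, given `X`,
the variables `U ∼ V(·|X)` and `Y ∼ W(·|X)` are independent. -/
def jointUY (P : stdSimplex ℝ A) (V : Channel A C) (W : Channel A B) (u : C) (y : B) : ℝ :=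
  ∑ x, P x * V x u * W x y

/-- The law of `U` when `X ∼ P` and `U ∼ V(·|X)`. -/
def lawU (P : stdSimplex ℝ A) (V : Channel A C) (u : C) : ℝ :=
  ∑ x, P x * V x u

/-- The largest value, over all estimators `P_{Û|Y}`, of
`E (P_{Û|Y}(U|Y) ^ ((a - 1) / a))`, where `J` is the joint law of `(U, Y)`. -/
def posteriorGain (J : C → B → ℝ) (a : ℝ) : ℝ :=
  ⨆ Q : Channel B C, ∑ u, ∑ y, J u y * (Q y u) ^ ((a - 1) / a)

/-- The largest value, over all blind estimators `P_Û`, of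
`E (P_Û(U) ^ ((a - 1) / a))`, where `p` is the law of `U`. -/
def priorGain (p : C → ℝ) (a : ℝ) : ℝ :=
  ⨆ q : stdSimplex ℝ C, ∑ u, p u * (q u) ^ ((a - 1) / a)

/-- `a / (a - 1)` times the logarithm of the multiplicative increase of the expected gain in
guessing `U` that is due to the observation of `Y`. -/
def logGainRatio (P : stdSimplex ℝ A) (V : Channel A C) (W : Channel A B) (a : ℝ) : ℝ :=
  a / (a - 1) * Real.log (posteriorGain (jointUY P V W) a / priorGain (lawU P V) a)

/-- The filter of `a → α` for real orders `1 < a`, `a ≠ α`, where `α ∈ [1, ∞]`. -/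
def orderFilter (α : ℝ≥0∞) : Filter ℝ :=
  if α = ⊤ then atTop else 𝓝[Set.Ioi 1 \ {α.toReal}] α.toReal

/-- Maximal `α`-leakage from `X ∼ P` to `Y ∼ W(·|X)`: the supremum, over all finite-valued
(possibly randomized) functions `U` of `X`, of the limit as `a → α` of `logGainRatio`.
The limit exists, see `exists_tendsto_logGainRatio`. The supremum is taken in the extended reals. -/
def maxLeakage (P : stdSimplex ℝ A) (W : Channel A B) (α : ℝ≥0∞) : EReal :=
  ⨆ (N : ℕ) (V : Channel A (Fin N)), ((limUnder (orderFilter α) (logGainRatio P V W) : ℝ) : EReal)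

/-- The hard distortion constraint: `d(X, Y) ≤ D` with probability one. -/
def IsFeasible (P : stdSimplex ℝ A) (d : A → B → ℝ) (D : ℝ) (W : Channel A B) : Prop :=
  ∀ x y, P x * W x y ≠ 0 → d x y ≤ D

/-- The optimal privacy-utility tradeoff: the least maximal `α`-leakage of a mechanism which
satisfies the hard distortion constraint. -/
def optimalTradeoff (P : stdSimplex ℝ A) (d : A → B → ℝ) (D : ℝ) (α : ℝ≥0∞) : EReal :=
  ⨅ W ∈ {W : Channel A B | IsFeasible P d D W}, maxLeakage P W α

open scoped Classical in
/-- The mechanism which outputs `f x` with probability one on input `x`. -/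
def deterministic (f : A → B) : Channel A B := fun x => stdSimplex.vertex (f x)

/-! Existence of the limit in the definition of maximal `α`-leakage. -/

theorem nonempty_of_stdSimplex (p : stdSimplex ℝ C) : Nonempty C := by
  by_contra h
  rw [not_nonempty_iff] at h
  have := p.2.2
  simp at this

theorem continuousOn_iSup {K : Type*} [TopologicalSpace K] [CompactSpace K] (F : ℝ → K → ℝ)
    (hF : ContinuousOn (fun z : ℝ × K => F z.1 z.2) (Set.Ioi 0 ×ˢ Set.univ)) :
    ContinuousOn (fun s => ⨆ k, F s k) (Set.Ioi 0) := by
  rw [continuousOn_iff_continuous_domRestrict]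
  have h : Continuous fun z : Set.Ioi (0 : ℝ) × K => F z.1 z.2 :=
    hF.comp_continuous (f := fun z : Set.Ioi (0 : ℝ) × K => ((z.1 : ℝ), z.2))
      (by fun_prop) (fun z => ⟨z.1.2, trivial⟩)
  have := isCompact_univ.continuous_sSup (f := fun (s : Set.Ioi (0 : ℝ)) k => F s k) h
  simp only [Set.image_univ, sSup_range] at this
  exact this

theorem continuous_apply_stdSimplex (c : C) : Continuous fun q : stdSimplex ℝ C => q c :=
  (continuous_apply c).comp continuous_subtype_val

theorem continuousOn_rpow_aux {K : Type*} [TopologicalSpace K] {g : K → ℝ} (hg : Continuous g) :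
    ContinuousOn (fun z : ℝ × K => (g z.2) ^ z.1) (Set.Ioi 0 ×ˢ Set.univ) := by
  rintro ⟨s, k⟩ ⟨hs, -⟩
  refine ContinuousAt.continuousWithinAt ?_
  have h1 : ContinuousAt (fun p : ℝ × ℝ => p.1 ^ p.2) (g k, s) :=
    Real.continuousAt_rpow _ (Or.inr hs)
  have h2 : Continuous fun z : ℝ × K => (g z.2, z.1) := by fun_prop
  exact ContinuousAt.comp (f := fun z : ℝ × K => (g z.2, z.1)) (x := (s, k)) h1 h2.continuousAt

/-- Both gains are positive, continuous functions of the exponent; common form. -/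
theorem gain_aux {K I : Type*} [TopologicalSpace K] [CompactSpace K] [Fintype I]
    (w : I → ℝ) (hw : ∀ i, 0 ≤ w i) (hw' : ∃ i, 0 < w i) (g : I → K → ℝ)
    (hg : ∀ i, Continuous (g i)) (hg0 : ∀ i k, 0 ≤ g i k) (k₀ : K) (hk₀ : ∀ i, 0 < g i k₀) :
    ContinuousOn (fun s : ℝ => ⨆ k, ∑ i, w i * (g i k) ^ s) (Set.Ioi 0) ∧
      ∀ s ∈ Set.Ioi (0 : ℝ), 0 < ⨆ k, ∑ i, w i * (g i k) ^ s := by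
  have hF : ContinuousOn (fun z : ℝ × K => ∑ i, w i * (g i z.2) ^ z.1)
      (Set.Ioi 0 ×ˢ Set.univ) :=
    continuousOn_finsetSum _ fun i _ => continuousOn_const.mul (continuousOn_rpow_aux (hg i))
  refine ⟨continuousOn_iSup (fun s k => ∑ i, w i * (g i k) ^ s) hF, fun s hs => ?_⟩
  have hc : Continuous fun k => ∑ i, w i * (g i k) ^ s :=
    hF.comp_continuous (f := fun k : K => (s, k)) (by fun_prop) (fun k => ⟨hs, trivial⟩)
  refine lt_of_lt_of_le ?_ (le_ciSup (isCompact_range hc).bddAbove k₀)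
  obtain ⟨i, hi⟩ := hw'
  exact Finset.sum_pos' (fun j _ => mul_nonneg (hw j) (Real.rpow_nonneg (hg0 j k₀) _))
    ⟨i, Finset.mem_univ _, mul_pos hi (Real.rpow_pos_of_pos (hk₀ i) _)⟩

theorem exists_tendsto_logGainRatio (P : stdSimplex ℝ A) (V : Channel A C) (W : Channel A B)
    {α : ℝ≥0∞} (hα : 1 < α) :
    ∃ L : ℝ, Tendsto (logGainRatio P V W) (orderFilter α) (𝓝 L) := by
  have sum1 : ∀ {D : Type} [Fintype D] (p : stdSimplex ℝ D), ∑ d, p d = 1 := fun p => p.2.2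
  have nn : ∀ {D : Type} [Fintype D] (p : stdSimplex ℝ D) (d : D), 0 ≤ p d := fun p => p.2.1
  have pos : ∀ {D : Type} [Fintype D] (p : stdSimplex ℝ D), ∃ d, 0 < p d := by
    intro D _ p
    by_contra! h
    have := Finset.sum_nonpos (s := Finset.univ) fun d _ => h d
    rw [sum1] at this
    linarith
  obtain ⟨x, hx⟩ := pos P
  obtain ⟨u, hu⟩ := pos (V x)
  obtain ⟨y, hy⟩ := pos (W x)
  have : Nonempty C := ⟨u⟩
  let b : stdSimplex ℝ C := stdSimplex.barycenter
  have hb : ∀ c, 0 < b c := by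
    intro c
    show (0 : ℝ) < (Fintype.card C : ℝ)⁻¹
    have : 0 < Fintype.card C := Fintype.card_pos
    positivity
  obtain ⟨cn, pn⟩ := gain_aux (I := C × B) (K := Channel B C)
    (fun i => jointUY P V W i.1 i.2)
    (fun i => Finset.sum_nonneg fun x _ => mul_nonneg (mul_nonneg (nn _ _) (nn _ _)) (nn _ _))
    ⟨(u, y), Finset.sum_pos'
      (fun x _ => mul_nonneg (mul_nonneg (nn _ _) (nn _ _)) (nn _ _))
      ⟨x, Finset.mem_univ _, mul_pos (mul_pos hx hu) hy⟩⟩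
    (fun i Q => Q i.2 i.1)
    (fun i => (continuous_apply_stdSimplex i.1).comp (continuous_apply i.2))
    (fun i Q => nn _ _) (fun _ => b) (fun i => hb _)
  obtain ⟨cd, pd⟩ := gain_aux (I := C) (K := stdSimplex ℝ C)
    (fun c => lawU P V c)
    (fun c => Finset.sum_nonneg fun x _ => mul_nonneg (nn _ _) (nn _ _))
    ⟨u, Finset.sum_pos'
      (fun x _ => mul_nonneg (nn _ _) (nn _ _))
      ⟨x, Finset.mem_univ _, mul_pos hx hu⟩⟩
    (fun c q => q c) (fun c => continuous_apply_stdSimplex c)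
    (fun c q => nn _ _) b hb
  simp only [Fintype.sum_prod_type] at cn pn
  -- it suffices that `a / (a - 1)` and `(a - 1) / a` converge, the latter to a positive limit
  have key : ∀ {l : Filter ℝ} {t s : ℝ}, 0 < s →
      Tendsto (fun a : ℝ => a / (a - 1)) l (𝓝 t) → Tendsto (fun a : ℝ => (a - 1) / a) l (𝓝 s) →
      ∃ L : ℝ, Tendsto (logGainRatio P V W) l (𝓝 L) := by
    intro l t s hs h1 h2
    have c1 := (cn.continuousAt (Ioi_mem_nhds hs)).tendsto.comp h2
    have c2 := (cd.continuousAt (Ioi_mem_nhds hs)).tendsto.comp h2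
    exact ⟨_, h1.mul ((c1.div c2 (pd s hs).ne').log (div_pos (pn s hs) (pd s hs)).ne')⟩
  unfold orderFilter
  split_ifs with h
  · have h2 : Tendsto (fun a : ℝ => (a - 1) / a) atTop (𝓝 1) := by
      have : Tendsto (fun a : ℝ => 1 - a⁻¹) atTop (𝓝 (1 - 0)) :=
        tendsto_const_nhds.sub tendsto_inv_atTop_zero
      rw [sub_zero] at this
      refine this.congr' ?_
      filter_upwards [eventually_gt_atTop 0] with a ha
      field_simp
    have h1 : Tendsto (fun a : ℝ => a / (a - 1)) atTop (𝓝 1⁻¹) := by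
      refine (h2.inv₀ one_ne_zero).congr fun a => ?_
      rw [inv_div]
    exact key one_pos h1 h2
  · have h1 : 1 < α.toReal := by
      rw [← ENNReal.toReal_one]
      exact (ENNReal.toReal_lt_toReal ENNReal.one_ne_top h).2 hα
    have c : ContinuousAt (fun a : ℝ => a) α.toReal := continuousAt_id
    have c1 : ContinuousAt (fun a : ℝ => a / (a - 1)) α.toReal :=
      c.div (c.sub continuousAt_const) (by linarith)
    have c2 : ContinuousAt (fun a : ℝ => (a - 1) / a) α.toReal :=
      (c.sub continuousAt_const).div c (by linarith)
    exact key (div_pos (by linarith) (by linarith))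
      (c1.tendsto.mono_left nhdsWithin_le_nhds) (c2.tendsto.mono_left nhdsWithin_le_nhds)

end Leakage

section Types

/-- The type (empirical distribution) of the dataset `x`. -/
def empType {A : Type} [DecidableEq A] {n : ℕ} (x : Fin n → A) (a : A) : ℝ :=
  (Finset.univ.filter (fun i => x i = a)).card / (n : ℝ)

/-- The distance between types: the largest value of `|P_x(a) - P_y(a)|` over the letters `a` of
the finite alphabet. -/
def typeDist {A : Type} [Fintype A] [DecidableEq A] {n : ℕ} (x y : Fin n → A) : ℝ :=
  ⨆ a : A, |empType x a - empType y a|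

/-- Binary datasets of length `n`. -/
abbrev Dataset (n : ℕ) : Type := Fin n → Fin 2

/-- The type class `T(i) = {x : n P_x(0) = i}` of binary datasets. -/
def typeClass (n i : ℕ) : Set (Dataset n) := {x | (n : ℝ) * empType x 0 = i}

/-- The number `⌈(n + 1) / (2 m + 1)⌉`. -/
def numClasses (n m : ℕ) : ℕ := ⌈((n : ℚ) + 1) / (2 * (m : ℚ) + 1)⌉₊

/-- The first index `l`; the truncated subtractions here are exact
(`0 < numClasses n m` and `(numClasses n m - 1) * (2 * m + 1) ≤ n`). -/
def firstIndex (n m : ℕ) : ℕ :=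
  if m + (numClasses n m - 1) * (2 * m + 1) ≤ n then m
  else n - (numClasses n m - 1) * (2 * m + 1)

/-- The set `{T(l + (2 m + 1) k) : 0 ≤ k ≤ ⌈(n + 1) / (2 m + 1)⌉ - 1}` of type classes. -/
def outputClasses (n m : ℕ) : Set (Set (Dataset n)) :=
  {T | ∃ k, k ≤ numClasses n m - 1 ∧ T = typeClass n (firstIndex n m + (2 * m + 1) * k)}

end Types

end HardDistortion

end

/-! Write `s = (a - 1) / a` and let `K` be the number of output classes. The theorem compares the
covering and packing of `{0, …, n}`, the set of zero counts, by intervals of radius `m`: both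
numbers equal `K`.

Covering gives the upper bound. Guessing after seeing one of `K` possible outputs is at most `K ^ s`
times as good as guessing blindly with the average of the `K` conditional estimators
(`posteriorGain_le`), and the prefactor `1 / s` turns this into `log K`.

Packing gives the lower bound. Datasets with `(2m + 1) j` zeros, `j < K`, have no common feasible
output, so every feasible mechanism reveals which of them was the input. Let `U` have `K` rare
values of equal mass `ε`, each revealing one such dataset, and spread its remaining mass over `N`
values. As `N → ∞` the remainder contributes nothing to the blind gain, and the gain ratio is at
least `Kε / (ε K ^ (1 - s)) = K ^ s` in the limit (`log_card_le_maxLeakage`). Neither bound depends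
on the order or on `P`. -/

namespace HardDistortion

/-! ### Bounds on maximal leakage for general channels -/

section LeakageBounds

variable {A B C : Type} [Fintype A] [Fintype B] [Fintype C]

/-- Power mean inequality with exponent `s⁻¹ ≥ 1`, applied to the numbers `q i ^ s`. It limits what
a blind estimator can gain on equally likely values. -/
theorem sum_rpow_le_card_rpow {ι : Type*} [Fintype ι] {q : ι → ℝ} (hq : ∀ i, 0 ≤ q i)
    (hsum : ∑ i, q i ≤ 1) {s : ℝ} (hs : 0 < s) (hs1 : s ≤ 1) :
    ∑ i, q i ^ s ≤ (Fintype.card ι : ℝ) ^ (1 - s) := by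
  have hinv : 1 ≤ s⁻¹ := (one_le_inv₀ hs).2 hs1
  have h := Real.rpow_sum_le_const_mul_sum_rpow_of_nonneg Finset.univ hinv
    (f := fun i => q i ^ s) fun i _ => Real.rpow_nonneg (hq i) s
  simp only [Real.rpow_rpow_inv (hq _) hs.ne', Finset.card_univ] at h
  have hc : (0 : ℝ) ≤ (Fintype.card ι : ℝ) ^ (s⁻¹ - 1) := by positivity
  have hS : 0 ≤ ∑ i, q i ^ s := Finset.sum_nonneg fun i _ => Real.rpow_nonneg (hq i) s
  calc ∑ i, q i ^ s = ((∑ i, q i ^ s) ^ s⁻¹) ^ s := (Real.rpow_inv_rpow hS hs.ne').symm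
    _ ≤ ((Fintype.card ι : ℝ) ^ (s⁻¹ - 1)) ^ s :=
        Real.rpow_le_rpow (by positivity) (h.trans (mul_le_of_le_one_right hc hsum)) hs.le
    _ = (Fintype.card ι : ℝ) ^ (1 - s) := by
        rw [← Real.rpow_mul (by positivity)]
        congr 1
        field_simp

theorem jointUY_nonneg (P : stdSimplex ℝ A) (V : Channel A C) (W : Channel A B) (u : C) (y : B) :
    0 ≤ jointUY P V W u y :=
  Finset.sum_nonneg fun x _ => mul_nonneg (mul_nonneg (P.2.1 x) ((V x).2.1 u)) ((W x).2.1 y)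

theorem lawU_nonneg (P : stdSimplex ℝ A) (V : Channel A C) (u : C) : 0 ≤ lawU P V u :=
  Finset.sum_nonneg fun x _ => mul_nonneg (P.2.1 x) ((V x).2.1 u)

theorem sum_jointUY (P : stdSimplex ℝ A) (V : Channel A C) (W : Channel A B) (u : C) :
    ∑ y, jointUY P V W u y = lawU P V u := by
  unfold jointUY lawU
  rw [Finset.sum_comm]
  refine Finset.sum_congr rfl fun x _ => ?_
  rw [← Finset.mul_sum, show ∑ y, W x y = 1 from (W x).2.2, mul_one]

theorem stdSimplex_rpow_le_one (q : stdSimplex ℝ C) (u : C) {s : ℝ} (hs : 0 ≤ s) :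
    q u ^ s ≤ 1 :=
  Real.rpow_le_one (q.2.1 u)
    ((Finset.single_le_sum (fun i _ => q.2.1 i) (Finset.mem_univ u)).trans_eq q.2.2) hs

theorem le_posteriorGain {J : C → B → ℝ} (hJ : ∀ u y, 0 ≤ J u y) {a : ℝ} (ha : 1 < a)
    (Q : Channel B C) : ∑ u, ∑ y, J u y * (Q y u) ^ ((a - 1) / a) ≤ posteriorGain J a := by
  refine le_ciSup (f := fun Q : Channel B C => ∑ u, ∑ y, J u y * (Q y u) ^ ((a - 1) / a))
    ⟨∑ u, ∑ y, J u y, ?_⟩ Q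
  rintro _ ⟨R, rfl⟩
  exact Finset.sum_le_sum fun u _ => Finset.sum_le_sum fun y _ => mul_le_of_le_one_right (hJ u y)
    (stdSimplex_rpow_le_one _ _ (div_nonneg (by linarith) (by linarith)))

theorem le_priorGain {p : C → ℝ} (hp : ∀ u, 0 ≤ p u) {a : ℝ} (ha : 1 < a)
    (q : stdSimplex ℝ C) : ∑ u, p u * (q u) ^ ((a - 1) / a) ≤ priorGain p a := by
  refine le_ciSup (f := fun q : stdSimplex ℝ C => ∑ u, p u * (q u) ^ ((a - 1) / a))
    ⟨∑ u, p u, ?_⟩ q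
  rintro _ ⟨r, rfl⟩
  exact Finset.sum_le_sum fun u _ => mul_le_of_le_one_right (hp u)
    (stdSimplex_rpow_le_one _ _ (div_nonneg (by linarith) (by linarith)))

theorem priorGain_nonneg {p : C → ℝ} (hp : ∀ u, 0 ≤ p u) (a : ℝ) : 0 ≤ priorGain p a :=
  Real.iSup_nonneg fun q => Finset.sum_nonneg fun u _ =>
    mul_nonneg (hp u) (Real.rpow_nonneg (q.2.1 u) _)

theorem posteriorGain_nonneg {J : C → B → ℝ} (hJ : ∀ u y, 0 ≤ J u y) (a : ℝ) :
    0 ≤ posteriorGain J a :=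
  Real.iSup_nonneg fun Q => Finset.sum_nonneg fun u _ => Finset.sum_nonneg fun y _ =>
    mul_nonneg (hJ u y) (Real.rpow_nonneg ((Q y).2.1 u) _)

/-- An observation with values in a finite set `S` multiplies the gain by at most a power of the
cardinality of `S`: compare with the blind estimator which averages over `S`. -/
theorem posteriorGain_le {J : C → B → ℝ} (hJ : ∀ u y, 0 ≤ J u y) {S : Finset B}
    (hS : S.Nonempty) (hJS : ∀ u, ∀ y ∉ S, J u y = 0) {a : ℝ} (ha : 1 < a) :
    posteriorGain J a ≤
      (S.card : ℝ) ^ ((a - 1) / a) * priorGain (fun u => ∑ y, J u y) a := by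
  have hc : (0 : ℝ) < S.card := by exact_mod_cast hS.card_pos
  have hs : 0 ≤ (a - 1) / a := div_nonneg (by linarith) (by linarith)
  have hprior : 0 ≤ priorGain (fun u => ∑ y, J u y) a :=
    priorGain_nonneg (fun u => Finset.sum_nonneg fun y _ => hJ u y) a
  refine Real.iSup_le (fun Q => ?_) (by positivity)
  let q : stdSimplex ℝ C := ⟨fun u => (S.card : ℝ)⁻¹ * ∑ y ∈ S, Q y u,
    fun u => mul_nonneg (by positivity) (Finset.sum_nonneg fun y _ => (Q y).2.1 u), by
      rw [← Finset.mul_sum, Finset.sum_comm,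
        Finset.sum_congr rfl fun y _ => show ∑ u, Q y u = 1 from (Q y).2.2]
      simp [hc.ne']⟩
  have hq : ∀ u, q u = (S.card : ℝ)⁻¹ * ∑ y ∈ S, Q y u := fun _ => rfl
  calc ∑ u, ∑ y, J u y * (Q y u) ^ ((a - 1) / a)
      ≤ ∑ u, ∑ y, J u y * ((S.card : ℝ) ^ ((a - 1) / a) * (q u) ^ ((a - 1) / a)) := by
        refine Finset.sum_le_sum fun u _ => Finset.sum_le_sum fun y _ => ?_
        by_cases hy : y ∈ S
        · refine mul_le_mul_of_nonneg_left ?_ (hJ u y)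
          -- `S.card * q u` is the sum of `Q z u` over `z ∈ S`, which dominates its single term at
          -- `y`.
          rw [← Real.mul_rpow hc.le (show 0 ≤ q u from q.2.1 u), hq, mul_inv_cancel_left₀ hc.ne']
          exact Real.rpow_le_rpow ((Q y).2.1 u)
            (Finset.single_le_sum (f := fun y => Q y u) (fun z _ => (Q z).2.1 u) hy) hs
        · simp [hJS u y hy]
    _ = (S.card : ℝ) ^ ((a - 1) / a) * ∑ u, (∑ y, J u y) * (q u) ^ ((a - 1) / a) := by
        rw [Finset.mul_sum]
        refine Finset.sum_congr rfl fun u _ => ?_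
        rw [← Finset.sum_mul]
        ring
    _ ≤ _ := mul_le_mul_of_nonneg_left
        (le_priorGain (fun u => Finset.sum_nonneg fun y _ => hJ u y) ha q) (by positivity)

/-! ### Orders tending to `α` -/

theorem orderFilter_neBot {α : ℝ≥0∞} (hα : 1 < α) : (orderFilter α).NeBot := by
  unfold orderFilter
  split_ifs with h
  · infer_instance
  · have h1 : 1 < α.toReal := by
      rw [← ENNReal.toReal_one]
      exact (ENNReal.toReal_lt_toReal ENNReal.one_ne_top h).2 hα
    -- Since `1 < α`, the condition `1 < a` is void near `α`, which leaves the punctured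
    -- neighbourhood filter.
    rw [Set.sdiff_eq, Set.inter_comm,
      nhdsWithin_inter_of_mem' (mem_nhdsWithin_of_mem_nhds (Ioi_mem_nhds h1))]
    infer_instance

theorem eventually_one_lt_orderFilter (α : ℝ≥0∞) : ∀ᶠ a in orderFilter α, 1 < a := by
  unfold orderFilter
  split_ifs
  · exact eventually_gt_atTop 1
  · filter_upwards [self_mem_nhdsWithin] with a ha using ha.1

theorem exists_tendsto_exponent {α : ℝ≥0∞} (hα : 1 < α) :
    ∃ s : ℝ, 0 < s ∧ s ≤ 1 ∧ Tendsto (fun a : ℝ => (a - 1) / a) (orderFilter α) (𝓝 s) := by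
  unfold orderFilter
  split_ifs with h
  · refine ⟨1, one_pos, le_rfl, ?_⟩
    have : Tendsto (fun a : ℝ => 1 - a⁻¹) atTop (𝓝 (1 - 0)) :=
      tendsto_const_nhds.sub tendsto_inv_atTop_zero
    rw [sub_zero] at this
    refine this.congr' ?_
    filter_upwards [eventually_gt_atTop 0] with a ha
    field_simp
  · have h1 : 1 < α.toReal := by
      rw [← ENNReal.toReal_one]
      exact (ENNReal.toReal_lt_toReal ENNReal.one_ne_top h).2 hα
    have c : ContinuousAt (fun a : ℝ => (a - 1) / a) α.toReal :=
      (continuousAt_id.sub continuousAt_const).div continuousAt_id (by simp; linarith)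
    exact ⟨_, div_pos (by linarith) (by linarith), (div_le_one (by linarith)).2 (by linarith),
      c.tendsto.mono_left nhdsWithin_le_nhds⟩

/-! ### Upper and lower bounds by the logarithm of a cardinality -/

theorem maxLeakage_le_log_card (P : stdSimplex ℝ A) (W : Channel A B) {S : Finset B}
    (hS : S.Nonempty) (hW : ∀ x, ∀ y ∉ S, W x y = 0) {α : ℝ≥0∞} (hα : 1 < α) :
    maxLeakage P W α ≤ ((Real.log S.card : ℝ) : EReal) := by
  refine iSup₂_le fun N V => EReal.coe_le_coe_iff.2 ?_
  obtain ⟨L, hL⟩ := exists_tendsto_logGainRatio P V W hα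
  have := orderFilter_neBot hα
  rw [hL.limUnder_eq]
  refine le_of_tendsto hL ?_
  filter_upwards [eventually_one_lt_orderFilter α] with a ha
  have hc : (0 : ℝ) < S.card := by exact_mod_cast hS.card_pos
  have hc1 : (1 : ℝ) ≤ S.card := by exact_mod_cast hS.card_pos
  have hs : 0 < (a - 1) / a := div_pos (by linarith) (by linarith)
  have hpost := posteriorGain_le (jointUY_nonneg P V W) hS
    (fun u y hy => Finset.sum_eq_zero fun x _ => by rw [hW x y hy, mul_zero]) ha
  simp only [sum_jointUY] at hpost
  have hprior := priorGain_nonneg (lawU_nonneg P V) a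
  have hratio := div_le_of_le_mul₀ hprior (by positivity) hpost
  have hlog : Real.log (posteriorGain (jointUY P V W) a / priorGain (lawU P V) a) ≤
      (a - 1) / a * Real.log S.card := by
    rw [← Real.log_rpow hc]
    -- If the ratio is `0`, then its logarithm is `0` by convention, and `1 ≤ S.card` suffices.
    rcases (div_nonneg (posteriorGain_nonneg (jointUY_nonneg P V W) a) hprior).eq_or_lt with h | h
    · rw [← h, Real.log_zero]
      exact Real.log_nonneg (Real.one_le_rpow hc1 hs.le)
    · exact Real.log_le_log h hratio
  rw [logGainRatio, ← inv_div]
  exact (inv_mul_le_iff₀ hs).2 hlog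

/-- A randomized function of `X` with `K` rare values, the `j`-th of which reveals `X = xs j`, and
`N` further values which are nearly uninformative. -/
theorem exists_revealing_channel (P : stdSimplex ℝ A) {K N : ℕ} (hN : 0 < N) {xs : Fin K → A}
    (hxs : Function.Injective xs) {ε : ℝ} (hε : 0 < ε) (hP : ∀ x, ε ≤ P x) :
    ∃ V : Channel A (Fin (K + N)),
      (∀ j x, P x * V x (Fin.castAdd N j) = Set.indicator {xs j} (fun _ => ε) x) ∧
      ∀ i x, V x (Fin.natAdd K i) ≤ (N : ℝ)⁻¹ := by
  classical
  have hPpos : ∀ x, 0 < P x := fun x => hε.trans_le (hP x)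
  -- Conditional probability of the `j`-th rare value, scaled so that its joint mass with `xs j` is
  -- exactly `ε`; `ε ≤ P x` keeps it at most `1`.
  let c : A → Fin K → ℝ := fun x j => if x = xs j then ε / P x else 0
  have hc0 : ∀ x j, 0 ≤ c x j := fun x j => by
    have := hPpos x
    simp only [c]
    split_ifs <;> positivity
  have hc1 : ∀ x, ∑ j, c x j ≤ 1 := fun x => by
    by_cases h : ∃ j, x = xs j
    · obtain ⟨j, rfl⟩ := h
      rw [Finset.sum_eq_single j (fun i _ hi => if_neg fun h => hi (hxs h).symm) (by simp)]
      simp only [if_true]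
      exact (div_le_one (hPpos _)).2 (hP _)
    · rw [Finset.sum_eq_zero fun j _ => if_neg fun hj => h ⟨j, hj⟩]
      exact zero_le_one
  have hNpos : (0 : ℝ) < N := by exact_mod_cast hN
  refine ⟨fun x => ⟨Fin.append (c x) fun _ => (N : ℝ)⁻¹ * (1 - ∑ j, c x j), fun u => ?_, ?_⟩,
    fun j x => ?_, fun i x => ?_⟩
  · refine Fin.addCases (fun j => ?_) (fun i => ?_) u
    · rw [Fin.append_left]
      exact hc0 x j
    · rw [Fin.append_right]
      exact mul_nonneg (by positivity) (sub_nonneg.2 (hc1 x))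
  · rw [Fin.sum_univ_add]
    simp only [Fin.append_left, Fin.append_right, Finset.sum_const, Finset.card_univ,
      Fintype.card_fin, nsmul_eq_mul]
    rw [mul_inv_cancel_left₀ hNpos.ne']
    ring
  · show P x * Fin.append (c x) (fun _ => (N : ℝ)⁻¹ * (1 - ∑ j, c x j)) (Fin.castAdd N j) = _
    rw [Fin.append_left]
    by_cases h : x = xs j
    · simp only [c, if_pos h, Set.indicator_of_mem (Set.mem_singleton_iff.2 h)]
      exact mul_div_cancel₀ _ (hPpos x).ne'
    · simp [c, h]
  · show Fin.append (c x) (fun _ => (N : ℝ)⁻¹ * (1 - ∑ j, c x j)) (Fin.natAdd K i) ≤ _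
    rw [Fin.append_right]
    exact mul_le_of_le_one_right (by positivity)
      (sub_le_self _ (Finset.sum_nonneg fun j _ => hc0 x j))

/-- The output determines which `xs j` could have produced it, so naming the matching rare value is
always right on the rare event and earns `K * ε`. A blind estimator must spread its mass; the power
mean inequality bounds its gain on the rare and on the common values separately. -/
theorem logGainRatio_ge_of_revealing (P : stdSimplex ℝ A) (W : Channel A B) {K N : ℕ}
    (hK : 0 < K) (hN : 0 < N) {xs : Fin K → A}
    (hW : ∀ i j y, W (xs i) y ≠ 0 → W (xs j) y ≠ 0 → i = j) {ε : ℝ} (hε : 0 < ε)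
    {V : Channel A (Fin (K + N))}
    (hV : ∀ j x, P x * V x (Fin.castAdd N j) = Set.indicator {xs j} (fun _ => ε) x)
    (hV' : ∀ i x, V x (Fin.natAdd K i) ≤ (N : ℝ)⁻¹) {a : ℝ} (ha : 1 < a) :
    ((a - 1) / a)⁻¹ * Real.log (K * ε /
      (ε * (K : ℝ) ^ (1 - (a - 1) / a) + (N : ℝ)⁻¹ * (N : ℝ) ^ (1 - (a - 1) / a))) ≤
      logGainRatio P V W a := by
  classical
  have hs : 0 < (a - 1) / a := div_pos (by linarith) (by linarith)
  have hs1 : (a - 1) / a ≤ 1 := (div_le_one (by linarith)).2 (by linarith)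
  rw [logGainRatio, ← inv_div (a - 1) a]
  set s := (a - 1) / a with hsdef
  have hKpos : (0 : ℝ) < K := by exact_mod_cast hK
  have hNpos : (0 : ℝ) < N := by exact_mod_cast hN
  have hlaw : ∀ j, lawU P V (Fin.castAdd N j) = ε := fun j => by
    unfold lawU
    simp only [hV]
    rw [Finset.sum_eq_single (xs j)] <;> simp +contextual
  have hlaw' : ∀ i, lawU P V (Fin.natAdd K i) ≤ (N : ℝ)⁻¹ := fun i => by
    calc ∑ x, P x * V x (Fin.natAdd K i) ≤ ∑ x, P x * (N : ℝ)⁻¹ :=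
          Finset.sum_le_sum fun x _ => mul_le_mul_of_nonneg_left (hV' i x) (P.2.1 x)
      _ = (N : ℝ)⁻¹ := by
          rw [← Finset.sum_mul, show ∑ x, P x = 1 from P.2.2, one_mul]
  have hjoint : ∀ j y, jointUY P V W (Fin.castAdd N j) y = ε * W (xs j) y := fun j y => by
    unfold jointUY
    simp only [hV]
    rw [Finset.sum_eq_single (xs j)] <;> simp +contextual
  have hprior_pos : 0 < priorGain (lawU P V) a := by
    refine lt_of_lt_of_le ?_
      (le_priorGain (lawU_nonneg P V) ha (stdSimplex.vertex (Fin.castAdd N ⟨0, hK⟩)))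
    refine Finset.sum_pos' (fun u _ => mul_nonneg (lawU_nonneg P V u)
      (Real.rpow_nonneg ((stdSimplex.vertex (Fin.castAdd N ⟨0, hK⟩)).2.1 u) _))
      ⟨Fin.castAdd N ⟨0, hK⟩, Finset.mem_univ _, ?_⟩
    rw [hlaw, stdSimplex.vertex_coe, Pi.single_eq_same, Real.one_rpow, mul_one]
    exact hε
  have hprior : priorGain (lawU P V) a ≤
      ε * (K : ℝ) ^ (1 - s) + (N : ℝ)⁻¹ * (N : ℝ) ^ (1 - s) := by
    refine Real.iSup_le (fun q => ?_) (by positivity)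
    rw [← hsdef, Fin.sum_univ_add]
    have hq : (∑ j, q (Fin.castAdd N j)) + ∑ i, q (Fin.natAdd K i) = 1 := by
      rw [← Fin.sum_univ_add]
      exact q.2.2
    have hq1 : 0 ≤ ∑ j, q (Fin.castAdd N j) := Finset.sum_nonneg fun j _ => q.2.1 _
    have hq2 : 0 ≤ ∑ i, q (Fin.natAdd K i) := Finset.sum_nonneg fun j _ => q.2.1 _
    refine add_le_add ?_ ?_
    · simp only [hlaw]
      rw [← Finset.mul_sum]
      refine mul_le_mul_of_nonneg_left ?_ hε.le
      simpa using sum_rpow_le_card_rpow (q := fun j => q (Fin.castAdd N j)) (fun j => q.2.1 _)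
        (show ∑ j, q (Fin.castAdd N j) ≤ 1 by linarith) hs hs1
    · refine (Finset.sum_le_sum fun i _ => mul_le_mul_of_nonneg_right (hlaw' i)
        (Real.rpow_nonneg (show 0 ≤ q (Fin.natAdd K i) from q.2.1 _) s)).trans ?_
      rw [← Finset.mul_sum]
      refine mul_le_mul_of_nonneg_left ?_ (by positivity)
      simpa using sum_rpow_le_card_rpow (q := fun i => q (Fin.natAdd K i)) (fun i => q.2.1 _)
        (show ∑ i, q (Fin.natAdd K i) ≤ 1 by linarith) hs hs1
  have hpost : K * ε ≤ posteriorGain (jointUY P V W) a := by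
    -- The decoder. Outputs that no `xs j` can produce are decoded as `0`, which costs nothing.
    have hg : ∀ y, ∃ k : Fin K, ∀ j, W (xs j) y ≠ 0 → k = j := fun y => by
      by_cases h : ∃ j, W (xs j) y ≠ 0
      · obtain ⟨j, hj⟩ := h
        exact ⟨j, fun i hi => hW j i y hj hi⟩
      · exact ⟨⟨0, hK⟩, fun j hj => absurd ⟨j, hj⟩ h⟩
    choose g hg using hg
    refine le_trans ?_ (le_posteriorGain (jointUY_nonneg P V W) ha
      fun y => stdSimplex.vertex (Fin.castAdd N (g y)))
    rw [← hsdef, Fin.sum_univ_add]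
    refine le_add_of_le_of_nonneg (le_of_eq ?_) (Finset.sum_nonneg fun i _ =>
      Finset.sum_nonneg fun y _ => mul_nonneg (jointUY_nonneg P V W _ _)
        (Real.rpow_nonneg ((stdSimplex.vertex (Fin.castAdd N (g y))).2.1 _) _))
    have hterm : ∀ j y, jointUY P V W (Fin.castAdd N j) y *
        ((stdSimplex.vertex (Fin.castAdd N (g y)) : stdSimplex ℝ (Fin (K + N)))
          (Fin.castAdd N j)) ^ s = ε * W (xs j) y := fun j y => by
      rw [hjoint]
      by_cases h : W (xs j) y = 0
      · simp [h]
      · rw [hg y j h, stdSimplex.vertex_coe, Pi.single_eq_same, Real.one_rpow, mul_one]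
    simp only [hterm]
    simp only [← Finset.mul_sum, show ∀ j, ∑ y, W (xs j) y = 1 from fun j => (W (xs j)).2.2]
    simp [mul_comm]
  refine mul_le_mul_of_nonneg_left (Real.log_le_log (by positivity) ?_) (inv_nonneg.2 hs.le)
  exact div_le_div₀ (le_trans (by positivity) hpost) hpost hprior_pos hprior

/-- If some `K` inputs have outputs with disjoint supports, then the leakage is at least
`log K`. -/
theorem log_card_le_maxLeakage (P : stdSimplex ℝ A) (hP : ∀ x, 0 < P x) (W : Channel A B) {K : ℕ}
    (hK : 0 < K) {xs : Fin K → A} (hW : ∀ i j y, W (xs i) y ≠ 0 → W (xs j) y ≠ 0 → i = j)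
    {α : ℝ≥0∞} (hα : 1 < α) :
    ((Real.log K : ℝ) : EReal) ≤ maxLeakage P W α := by
  -- Each row of `W` has a nonzero entry, so disjoint supports force distinct inputs.
  have hxs : Function.Injective xs := fun i j hij => by
    obtain ⟨y, -, hy⟩ : ∃ y ∈ Finset.univ, W (xs i) y ≠ 0 := by
      refine Finset.exists_ne_zero_of_sum_ne_zero ?_
      rw [show ∑ y, W (xs i) y = 1 from (W (xs i)).2.2]
      exact one_ne_zero
    exact hW i j y hy (hij ▸ hy)
  have : Nonempty A := ⟨xs ⟨0, hK⟩⟩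
  obtain ⟨x₀, hx₀⟩ := Finite.exists_min fun x => P x
  have hε := hP x₀
  set ε := P x₀
  obtain ⟨s, hs, hs1, hlim⟩ := exists_tendsto_exponent hα
  have hKpos : (0 : ℝ) < K := by exact_mod_cast hK
  -- The order tends to `α` at fixed `N`, because the leakage takes this limit for each `U`; only
  -- afterwards `N → ∞`.
  have hbound : ∀ N : ℕ, 0 < N → ((s⁻¹ * Real.log (K * ε /
      (ε * (K : ℝ) ^ (1 - s) + (N : ℝ)⁻¹ * (N : ℝ) ^ (1 - s))) : ℝ) : EReal) ≤
      maxLeakage P W α := fun N hN => by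
    have hNpos : (0 : ℝ) < N := by exact_mod_cast hN
    obtain ⟨V, hV, hV'⟩ := exists_revealing_channel P hN hxs hε hx₀
    refine le_trans (EReal.coe_le_coe_iff.2 ?_) (le_iSup₂ (f := fun (N : ℕ)
      (V : Channel A (Fin N)) =>
        ((limUnder (orderFilter α) (logGainRatio P V W) : ℝ) : EReal)) (K + N) V)
    obtain ⟨L, hL⟩ := exists_tendsto_logGainRatio P V W hα
    have := orderFilter_neBot hα
    rw [hL.limUnder_eq]
    have hcont : ContinuousAt (fun t : ℝ => t⁻¹ * Real.log (K * ε /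
        (ε * (K : ℝ) ^ (1 - t) + (N : ℝ)⁻¹ * (N : ℝ) ^ (1 - t)))) s := by
      have h1 : ContinuousAt (fun t : ℝ => (K : ℝ) ^ (1 - t)) s :=
        continuousAt_const.rpow (continuousAt_const.sub continuousAt_id) (Or.inl hKpos.ne')
      have h2 : ContinuousAt (fun t : ℝ => (N : ℝ) ^ (1 - t)) s :=
        continuousAt_const.rpow (continuousAt_const.sub continuousAt_id) (Or.inl hNpos.ne')
      have h3 : 0 < ε * (K : ℝ) ^ (1 - s) + (N : ℝ)⁻¹ * (N : ℝ) ^ (1 - s) := by positivity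
      exact (continuousAt_id.inv₀ hs.ne').mul ((continuousAt_const.div
        ((continuousAt_const.mul h1).add (continuousAt_const.mul h2)) h3.ne').log
          (div_pos (by positivity) h3).ne')
    refine le_of_tendsto_of_tendsto (hcont.tendsto.comp hlim) hL ?_
    filter_upwards [eventually_one_lt_orderFilter α] with a ha
    exact logGainRatio_ge_of_revealing P W hK hN hW hε hV hV' ha
  have hN0 : Tendsto (fun N : ℕ => (N : ℝ)⁻¹ * (N : ℝ) ^ (1 - s)) atTop (𝓝 0) := by
    refine ((tendsto_rpow_neg_atTop hs).comp tendsto_natCast_atTop_atTop).congr' ?_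
    filter_upwards [eventually_gt_atTop 0] with N hN
    have hNpos : (0 : ℝ) < N := by exact_mod_cast hN
    rw [← Real.rpow_neg_one, ← Real.rpow_add hNpos]
    simp only [Function.comp_apply]
    congr 1
    ring
  have h3 : 0 < ε * (K : ℝ) ^ (1 - s) + 0 := by positivity
  have hlog : Tendsto (fun N : ℕ => s⁻¹ * Real.log (K * ε /
      (ε * (K : ℝ) ^ (1 - s) + (N : ℝ)⁻¹ * (N : ℝ) ^ (1 - s)))) atTop
      (𝓝 (s⁻¹ * Real.log (K * ε / (ε * (K : ℝ) ^ (1 - s) + 0)))) :=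
    ((tendsto_const_nhds.div (tendsto_const_nhds.add hN0) h3.ne').log (by positivity)).const_mul _
  have hval : s⁻¹ * Real.log (K * ε / (ε * (K : ℝ) ^ (1 - s) + 0)) = Real.log K := by
    -- Here `ε` cancels, and with it all dependence on `P`.
    have : K * ε / (ε * (K : ℝ) ^ (1 - s) + 0) = (K : ℝ) ^ s := by
      rw [add_zero, Real.rpow_sub hKpos, Real.rpow_one]
      have : (0 : ℝ) < (K : ℝ) ^ s := by positivity
      field_simp
    rw [this, Real.log_rpow hKpos, inv_mul_cancel_left₀ hs.ne']
  rw [hval] at hlog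
  refine le_of_tendsto ((continuous_coe_real_ereal.tendsto _).comp hlog) ?_
  filter_upwards [eventually_gt_atTop 0] with N hN using hbound N hN

end LeakageBounds

end HardDistortion

namespace HardDistortion

theorem deterministic_apply_of_ne {A B : Type} [Fintype B] {f : A → B} {x : A} {y : B}
    (h : y ≠ f x) : deterministic f x y = 0 := by
  classical
  exact Pi.single_eq_of_ne h _

/-! ### Binary types as zero counts -/

section BinaryTypes

variable {n m : ℕ}

/-- The number of zeros in a binary dataset. -/
def zeroCount (x : Dataset n) : ℕ := (Finset.univ.filter fun i => x i = 0).card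

theorem zeroCount_le (x : Dataset n) : zeroCount x ≤ n := by
  simpa [zeroCount] using Finset.card_filter_le (Finset.univ : Finset (Fin n)) fun i => x i = 0

theorem exists_zeroCount_eq {i : ℕ} (hi : i ≤ n) : ∃ x : Dataset n, zeroCount x = i :=
  ⟨fun j => if (j : ℕ) < i then 0 else 1, by
    simp [zeroCount, Fin.card_filter_val_lt, hi]⟩

theorem empType_zero (x : Dataset n) : empType x 0 = (zeroCount x : ℝ) / n := rfl

theorem empType_one (x : Dataset n) : empType x 1 = ((n : ℝ) - zeroCount x) / n := by
  have h := Finset.card_filter_add_card_filter_not (s := (Finset.univ : Finset (Fin n)))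
    fun i => x i = 0
  have h1 : (Finset.univ.filter fun i => ¬x i = 0) = Finset.univ.filter fun i => x i = 1 := by
    refine Finset.filter_congr fun i _ => ?_
    have := x i
    omega
  rw [h1, Finset.card_univ, Fintype.card_fin] at h
  have h2 : (zeroCount x : ℝ) + (Finset.univ.filter fun i => x i = 1).card = n := by
    exact_mod_cast h
  rw [empType, ← h2]
  ring

/-- The frequencies of the two letters sum to a constant, so both letters deviate equally and the
maximum is over equal numbers. -/
theorem typeDist_eq (x y : Dataset n) :
    typeDist x y = |(zeroCount x : ℝ) - zeroCount y| / n := by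
  have h : ∀ a : Fin 2, |empType x a - empType y a| = |(zeroCount x : ℝ) - zeroCount y| / n := by
    intro a
    rw [show |(zeroCount x : ℝ) - zeroCount y| / n = |((zeroCount x : ℝ) - zeroCount y) / n| by
      rw [abs_div, Nat.abs_cast]]
    fin_cases a
    · show |empType x 0 - empType y 0| = _
      rw [empType_zero, empType_zero, ← sub_div]
    · show |empType x 1 - empType y 1| = _
      rw [empType_one, empType_one, ← sub_div, sub_sub_sub_cancel_left, ← abs_neg, ← neg_div,
        neg_sub]
  simp only [typeDist, h, ciSup_const]

theorem typeDist_le_iff (hn : 1 ≤ n) (x y : Dataset n) :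
    typeDist x y ≤ (m : ℝ) / n ↔
      zeroCount x ≤ zeroCount y + m ∧ zeroCount y ≤ zeroCount x + m := by
  have : (0 : ℝ) < n := by exact_mod_cast hn
  rw [typeDist_eq, div_le_div_iff_of_pos_right this, abs_le, neg_le_sub_iff_le_add,
    sub_le_iff_le_add', and_comm]
  norm_cast

theorem mem_typeClass (hn : 1 ≤ n) {i : ℕ} {x : Dataset n} :
    x ∈ typeClass n i ↔ zeroCount x = i := by
  have : (n : ℝ) ≠ 0 := by positivity
  rw [typeClass, Set.mem_ofPred_eq, empType_zero, mul_div_cancel₀ _ this]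
  norm_cast

/-! ### Covering of the zero counts by intervals of radius `m` -/

theorem numClasses_pos (n m : ℕ) : 0 < numClasses n m :=
  Nat.ceil_pos.2 (by positivity)

theorem le_numClasses_mul (n m : ℕ) : n + 1 ≤ (2 * m + 1) * numClasses n m := by
  have h := Nat.le_ceil (((n : ℚ) + 1) / (2 * (m : ℚ) + 1))
  rw [div_le_iff₀ (by positivity)] at h
  have h' : (n : ℚ) + 1 ≤ (numClasses n m : ℚ) * (2 * m + 1) := h
  rw [mul_comm]
  exact_mod_cast h'

theorem numClasses_sub_one_mul_le (n m : ℕ) : (2 * m + 1) * (numClasses n m - 1) ≤ n := by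
  have h := Nat.ceil_lt_add_one (show (0 : ℚ) ≤ ((n : ℚ) + 1) / (2 * (m : ℚ) + 1) by positivity)
  obtain ⟨k, hk⟩ := Nat.exists_eq_succ_of_ne_zero (numClasses_pos n m).ne'
  have h' : (numClasses n m : ℚ) < ((n : ℚ) + 1) / (2 * (m : ℚ) + 1) + 1 := h
  rw [hk, Nat.cast_succ, add_lt_add_iff_right, lt_div_iff₀ (by positivity), mul_comm] at h'
  rw [hk, Nat.succ_sub_one]
  exact Nat.lt_succ_iff.1 (by exact_mod_cast h')

theorem firstIndex_le (n m : ℕ) : firstIndex n m ≤ m := by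
  unfold firstIndex
  split_ifs with h <;> omega

theorem firstIndex_add_le (n m : ℕ) :
    firstIndex n m + (2 * m + 1) * (numClasses n m - 1) ≤ n := by
  have := numClasses_sub_one_mul_le n m
  unfold firstIndex
  rw [mul_comm (numClasses n m - 1)]
  split_ifs with h <;> omega

/-- Either the first index is `m` and the `K` blocks of length `2m + 1` start at `0` and reach past
`n`, or the last index is `n` itself. -/
theorem le_firstIndex_add (n m : ℕ) :
    n ≤ firstIndex n m + (2 * m + 1) * (numClasses n m - 1) + m := by
  have h1 := le_numClasses_mul n m
  have h2 := numClasses_sub_one_mul_le n m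
  obtain ⟨k, hk⟩ := Nat.exists_eq_succ_of_ne_zero (numClasses_pos n m).ne'
  unfold firstIndex
  rw [mul_comm (numClasses n m - 1)]
  rw [hk, Nat.succ_sub_one] at h2 ⊢
  rw [hk, Nat.mul_succ] at h1
  split_ifs with h <;> omega

/-- The index of the only class of `outputClasses n m` which is within distance `m` of the class
with `i` zeros. -/
def nearestIndex (n m i : ℕ) : ℕ := (i + m - firstIndex n m) / (2 * m + 1)

theorem nearestIndex_le {i : ℕ} (hi : i ≤ n) : nearestIndex n m i ≤ numClasses n m - 1 := by
  have h := le_firstIndex_add n m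
  refine Nat.lt_succ_iff.1 ((Nat.div_lt_iff_lt_mul (by positivity)).2 ?_)
  rw [Nat.succ_mul, mul_comm]
  omega

/-- With `l` the first index, the two inequalities say that `i + m - l` lies in the `k`-th block of
length `2m + 1`, that is, has quotient `k`. The subtraction is exact because `l ≤ m`. -/
theorem near_iff_eq_nearestIndex (n m i k : ℕ) :
    (i ≤ firstIndex n m + (2 * m + 1) * k + m ∧ firstIndex n m + (2 * m + 1) * k ≤ i + m) ↔
      k = nearestIndex n m i := by
  have h := firstIndex_le n m
  rw [eq_comm, nearestIndex, Nat.div_eq_iff (by positivity), mul_comm k]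
  omega

/-! ### Packing lower bound and the optimal mechanism -/

theorem log_numClasses_le_maxLeakage (hn : 1 ≤ n) (P : stdSimplex ℝ (Dataset n))
    (hP : ∀ x, 0 < P x) {W : Channel (Dataset n) (Dataset n)}
    (hW : IsFeasible P typeDist ((m : ℝ) / n) W) {α : ℝ≥0∞} (hα : 1 < α) :
    ((Real.log (numClasses n m) : ℝ) : EReal) ≤ maxLeakage P W α := by
  -- The packing starts at `0` zeros rather than at `firstIndex`. Centres differ by at least `2m +
  -- 1`, so two of them cannot both be within `m` of the same `y`.
  have hle : ∀ j : Fin (numClasses n m), (2 * m + 1) * (j : ℕ) ≤ n := fun j =>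
    (Nat.mul_le_mul_left _ (by omega)).trans (numClasses_sub_one_mul_le n m)
  choose xs hxs using fun j => exists_zeroCount_eq (hle j)
  refine log_card_le_maxLeakage P hP W (numClasses_pos n m) (xs := xs) (fun i j y hi hj => ?_) hα
  have h1 := (typeDist_le_iff hn _ _).1 (hW _ _ (mul_ne_zero (hP (xs i)).ne' hi))
  have h2 := (typeDist_le_iff hn _ _).1 (hW _ _ (mul_ne_zero (hP (xs j)).ne' hj))
  rw [hxs] at h1 h2
  by_contra hij
  rcases lt_or_gt_of_ne (Fin.val_injective.ne hij) with h | h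
  · have := Nat.mul_le_mul_left (2 * m + 1) (Nat.succ_le_of_lt h)
    rw [Nat.mul_succ] at this
    omega
  · have := Nat.mul_le_mul_left (2 * m + 1) (Nat.succ_le_of_lt h)
    rw [Nat.mul_succ] at this
    omega

theorem outputClasses_nonempty (hn : 1 ≤ n) {T : Set (Dataset n)} (hT : T ∈ outputClasses n m) :
    T.Nonempty := by
  obtain ⟨k, hk, rfl⟩ := hT
  obtain ⟨x, hx⟩ := exists_zeroCount_eq
    ((Nat.add_le_add_left (Nat.mul_le_mul_left _ hk) _).trans (firstIndex_add_le n m))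
  exact ⟨x, (mem_typeClass hn).2 hx⟩

/-- The map which sends a dataset to the representative, chosen by `r`, of the nearest output
class. -/
def nearestRepresentative (m : ℕ) (r : Set (Dataset n) → Dataset n) (x : Dataset n) : Dataset n :=
  r (typeClass n (firstIndex n m + (2 * m + 1) * nearestIndex n m (zeroCount x)))

variable {r : Set (Dataset n) → Dataset n}

theorem zeroCount_representative (hn : 1 ≤ n) (hr : ∀ T ∈ outputClasses n m, r T ∈ T) {k : ℕ}
    (hk : k ≤ numClasses n m - 1) :
    zeroCount (r (typeClass n (firstIndex n m + (2 * m + 1) * k))) =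
      firstIndex n m + (2 * m + 1) * k :=
  (mem_typeClass hn).1 (hr _ ⟨k, hk, rfl⟩)

/-- Representatives of different output classes have different zero counts, so equality of
representatives gives back equality of indices. -/
theorem typeDist_representative_le_iff (hn : 1 ≤ n) (hr : ∀ T ∈ outputClasses n m, r T ∈ T)
    (x : Dataset n) {T : Set (Dataset n)} (hT : T ∈ outputClasses n m) :
    typeDist x (r T) ≤ (m : ℝ) / n ↔ nearestRepresentative m r x = r T := by
  obtain ⟨k, hk, rfl⟩ := hT
  rw [typeDist_le_iff hn, zeroCount_representative hn hr hk, near_iff_eq_nearestIndex]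
  refine ⟨fun h => by rw [h, nearestRepresentative], fun h => ?_⟩
  have h' := congrArg zeroCount h
  rw [nearestRepresentative, zeroCount_representative hn hr (nearestIndex_le (zeroCount_le x)),
    zeroCount_representative hn hr hk] at h'
  exact (Nat.eq_of_mul_eq_mul_left (by positivity) (Nat.add_left_cancel h')).symm

theorem isFeasible_nearestRepresentative (hn : 1 ≤ n) (hr : ∀ T ∈ outputClasses n m, r T ∈ T)
    (P : stdSimplex ℝ (Dataset n)) :
    IsFeasible P typeDist ((m : ℝ) / n) (deterministic (nearestRepresentative m r)) := by
  intro x y hxy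
  have hy : y = nearestRepresentative m r x := by
    by_contra h
    exact hxy (by rw [deterministic_apply_of_ne h, mul_zero])
  rw [hy]
  exact (typeDist_representative_le_iff hn hr x
    ⟨_, nearestIndex_le (zeroCount_le x), rfl⟩).2 rfl

theorem maxLeakage_nearestRepresentative_le (hn : 1 ≤ n)
    (hr : ∀ T ∈ outputClasses n m, r T ∈ T) (P : stdSimplex ℝ (Dataset n))
    {α : ℝ≥0∞} (hα : 1 < α) :
    maxLeakage P (deterministic (nearestRepresentative m r)) α ≤
      ((Real.log (numClasses n m) : ℝ) : EReal) := by
  classical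
  have hK := numClasses_pos n m
  set S := (Finset.range (numClasses n m)).image fun k =>
    r (typeClass n (firstIndex n m + (2 * m + 1) * k)) with hS
  have hcard : S.card = numClasses n m := by
    rw [hS, Finset.card_image_of_injOn, Finset.card_range]
    -- The zero count of a representative recovers its index.
    intro i hi j hj hij
    have hi' := Finset.mem_range.1 hi
    have hj' := Finset.mem_range.1 hj
    have h := congrArg zeroCount hij
    simp only at h
    rw [zeroCount_representative hn hr (by omega), zeroCount_representative hn hr (by omega)] at h
    exact Nat.eq_of_mul_eq_mul_left (by positivity) (Nat.add_left_cancel h)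
  rw [← hcard]
  refine maxLeakage_le_log_card P _ (Finset.card_pos.1 (hcard ▸ hK)) (fun x y hy => ?_) hα
  have hne : y ≠ nearestRepresentative m r x := by
    rintro rfl
    refine hy (Finset.mem_image.2 ⟨nearestIndex n m (zeroCount x), Finset.mem_range.2 ?_, rfl⟩)
    have := nearestIndex_le (m := m) (zeroCount_le x)
    omega
  exact deterministic_apply_of_ne hne

end BinaryTypes

end HardDistortion

open HardDistortion in
theorem theorem5 (n m : ℕ) (hn : 1 ≤ n) (hm : m ≤ n)
    (P : stdSimplex ℝ (Dataset n)) (hP : ∀ x, 0 < P x) :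
    (∀ α : ENNReal, 1 < α →
      optimalTradeoff P typeDist ((m : ℝ) / n) α = ((Real.log (numClasses n m) : ℝ) : EReal)) ∧
    (∀ T ∈ outputClasses n m, T.Nonempty) ∧
    (∀ r : Set (Dataset n) → Dataset n, (∀ T ∈ outputClasses n m, r T ∈ T) →
      ∃ f : Dataset n → Dataset n,
        (∀ i ≤ n, ∃ T ∈ outputClasses n m, ∀ x ∈ typeClass n i, f x = r T) ∧
        (∀ x, ∀ T ∈ outputClasses n m, typeDist x (r T) ≤ (m : ℝ) / n ↔ f x = r T) ∧
        IsFeasible P typeDist ((m : ℝ) / n) (deterministic f) ∧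
        ∀ α : ENNReal, 1 < α →
          maxLeakage P (deterministic f) α = optimalTradeoff P typeDist ((m : ℝ) / n) α) := by
  have hlow : ∀ α : ENNReal, 1 < α → ((Real.log (numClasses n m) : ℝ) : EReal) ≤
      optimalTradeoff P typeDist ((m : ℝ) / n) α := fun α hα =>
    le_iInf₂ fun W hW => log_numClasses_le_maxLeakage hn P hP hW hα
  have hup : ∀ r : Set (Dataset n) → Dataset n, (∀ T ∈ outputClasses n m, r T ∈ T) →
      ∀ α : ENNReal, optimalTradeoff P typeDist ((m : ℝ) / n) α ≤
        maxLeakage P (deterministic (nearestRepresentative m r)) α := fun r hr α =>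
    iInf₂_le _ (isFeasible_nearestRepresentative hn hr P)
  refine ⟨fun α hα => le_antisymm ?_ (hlow α hα), fun T hT => outputClasses_nonempty hn hT,
    fun r hr => ⟨nearestRepresentative m r, fun i hi => ⟨_, ⟨_, nearestIndex_le hi, rfl⟩,
      fun x hx => ?_⟩, fun x T hT => typeDist_representative_le_iff hn hr x hT,
      isFeasible_nearestRepresentative hn hr P, fun α hα => le_antisymm
        ((maxLeakage_nearestRepresentative_le hn hr P hα).trans (hlow α hα)) (hup r hr α)⟩⟩
  · classical
    -- The value of the tradeoff needs only some choice of representatives; the default `0` is never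
    -- used on an output class.
    let r : Set (Dataset n) → Dataset n := fun T => if h : T.Nonempty then h.some else 0
    have hr : ∀ T ∈ outputClasses n m, r T ∈ T := fun T hT => by
      have h := outputClasses_nonempty hn hT
      simp only [r, dif_pos h]
      exact h.some_mem
    exact (hup r hr α).trans (maxLeakage_nearestRepresentative_le hn hr P hα)
  · rw [nearestRepresentative, (mem_typeClass hn).1 hx]
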